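/- All Banach spaces are real. For a bounded sequence $(x_n^*)$ in the dual $X^*$ of a Banach space $X$ put $$\delta_w(x_n^*)=\sup_{x^{**}\in B_{X^{**}}}\inf_{n\in\mathbb N}\sup_{k,l\ge n}|x^{**}(x_k^*)-x^{**}(x_l^*)|,\qquad \delta_{w^*}(x_n^*)=\sup_{x\in B_X}\inf_{n\in\mathbb N}\sup_{k,l\ge n}|x_k^*(x)-x_l^*(x)|,$$ where $B_{X}$ and $B_{X^{**}}$ are the closed unit balls of $X$ and of its bidual $X^{**}$. For $c\ge 1$, $X$ is called $c$-Grothendieck if $\delta_w(x_n^*)\le c\,\delta_{w^*}(x_n^*)$ for every bounded sequence $(x_n^*)$ in $X^*$; $X$ is called Grothendieck if weak and weak$^*$ convergence of sequences in $X^*$ coincide. Theorem. There is a Grothendieck Banach space which is not $c$-Grothendieck for any $c\ge 1$. More precisely, there are equivalent norms $\|\cdot\|_n$ ($n=1,2,\dots$) on $\ell_\infty$ such that $X_n=(\ell_\infty,\|\cdot\|_n)$ is not $n$-Grothendieck for each $n$, and such that the $\ell_2$-sum $X=\left(\bigoplus_{n\ge1} X_n\right)_{\ell_2}$ is a Grothendieck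 Banach space which is not $c$-Grothendieck for any $c\ge 1$. -/

import Mathlib

open Filter Topology
open scoped ENNReal

noncomputable section

/-- A normed space `X` is Grothendieck if weak and weak* convergence of sequences in the dual
`X*` coincide. (The weak topology of `X*` is the one induced by the bidual `X**`.) -/
def IsGrothendieck (X : Type*) [NormedAddCommGroup X] [NormedSpace ℝ X] : Prop :=
  ∀ (u : ℕ → StrongDual ℝ X) (f : StrongDual ℝ X),
    Tendsto (fun n => StrongDual.toWeakDual (u n)) atTop (𝓝 (StrongDual.toWeakDual f)) ↔
      Tendsto (fun n => toWeakSpace ℝ (StrongDual ℝ X) (u n)) atTop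
        (𝓝 (toWeakSpace ℝ (StrongDual ℝ X) f))

/-- The oscillation at infinity `inf_n sup_{k, l ≥ n} |a_k - a_l|` of a real sequence. -/
def oscAtTop (a : ℕ → ℝ) : ℝ≥0∞ :=
  ⨅ n : ℕ, ⨆ (k : ℕ) (_ : n ≤ k) (l : ℕ) (_ : n ≤ l), ENNReal.ofReal |a k - a l|

/-- The measure of weak non-Cauchyness `δ_w` of a sequence in `X*`: the supremum over the closed
unit ball of `X**`. It is finite when the sequence is bounded. -/
def deltaWeak {X : Type*} [NormedAddCommGroup X] [NormedSpace ℝ X]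
    (u : ℕ → StrongDual ℝ X) : ℝ≥0∞ :=
  ⨆ (F : StrongDual ℝ (StrongDual ℝ X)) (_ : ‖F‖ ≤ 1), oscAtTop fun k => F (u k)

/-- The measure of weak* non-Cauchyness `δ_{w*}` of a sequence in `X*`: the supremum over the
closed unit ball of `X`. It is finite when the sequence is bounded. -/
def deltaWeakStar {X : Type*} [NormedAddCommGroup X] [NormedSpace ℝ X]
    (u : ℕ → StrongDual ℝ X) : ℝ≥0∞ :=
  ⨆ (x : X) (_ : ‖x‖ ≤ 1), oscAtTop fun k => u k x

/-- `X` is `c`-Grothendieck (the notion is used for `c ≥ 1`) if `δ_w ≤ c δ_{w*}` for every bounded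
sequence in `X*`. -/
def IsQuantGrothendieck (c : ℝ) (X : Type*) [NormedAddCommGroup X] [NormedSpace ℝ X] : Prop :=
  ∀ u : ℕ → StrongDual ℝ X, Bornology.IsBounded (Set.range u) →
    deltaWeak u ≤ ENNReal.ofReal c * deltaWeakStar u

end

/-!
Why the theorem holds. Three facts carry it.

* **Renorming.** Give `ℓ_∞` the norm `max ‖x‖_∞ ((n + 1) dist(x, c_0))`. Its unit ball lies within
  `1 / (n + 1)` of `c_0`, so the coordinate functionals `e_k*` satisfy `δ_{w*} ≤ 2 / (n + 1)`. On
  `c_0` the norm is the old one, so the unit ball of the bidual contains the weak* closure of the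
  ball of `c_0`; in it there is an `F` with `F (e_k*) = (-1) ^ k`, which gives `δ_w ≥ 2`. Hence
  `δ_w ≤ n δ_{w*}` fails (`LInfty.Renormed.not_isQuantGrothendieck`). As each summand is
  `1`-complemented in the `ℓ_2`-sum, the sum is not `c`-Grothendieck for any `c`
  (`IsQuantGrothendieck.of_leftInverse`).

* **Sums.** The truncations of an `ℓ_2`-sum to finitely many summands are projections `P` with
  `‖x‖ ^ 2 = ‖P x‖ ^ 2 + ‖x - P x‖ ^ 2`, and so are their adjoints and second adjoints. Increasing
  families of such projections converge pointwise, so every element of the bidual is a norm limit of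
  truncations, and weak convergence reduces to the summands (`WeakStarNullIsWeaklyNull.lp_two`).

* **Grothendieck's theorem** for `ℓ_∞` (`LInfty.weakStarNullIsWeaklyNull`). Let `u k` be weak*-null
  in the dual of `ℓ_∞`. The norm of the restriction of `u k` to the elements supported in `S` is a
  finitely additive function of `S`, the variation of `u k`. By a gliding hump argument, based on
  Rosenthal's disjointification lemma, these variations are uniformly exhaustive
  (`LInfty.uniformlyExhaustive_variation`), and therefore uniformly absolutely continuous with
  respect to finitely many of them (`UniformlyExhaustive.exists_forall_lt`). If `y i` almost norms
  `u i`, then `z ↦ u i (y i * z)` is almost positive and almost represents the variation of `u i`;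
  a finite sum `L` of such functionals thus controls all `u k` at once: if `L (x * x)` is small,
  then so is `u k x`, uniformly in `k` (`LInfty.exists_forall_apply_mul_self_le`). Given `F` in the
  bidual ball, points of the ball of `ℓ_∞` approximate `F` on finitely many `u k`. Among such
  points take almost minimizers of `L (x * x)`; by the parallelogram law any two of them are close
  for this form, so a single `x` approximates `F` on all `u k` up to `ε`, and `u k x → 0` gives
  `F (u k) → 0`. This replaces the usual appeal to weak compactness in `L_1`.
-/

noncomputable section

/-! ### Weak and weak* convergence in duals -/

/-- Every weak*-null sequence in the dual of `X` is weakly null. -/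
def WeakStarNullIsWeaklyNull (X : Type*) [NormedAddCommGroup X] [NormedSpace ℝ X] : Prop :=
  ∀ u : ℕ → StrongDual ℝ X, (∀ x, Tendsto (fun n => u n x) atTop (𝓝 0)) →
    ∀ F : StrongDual ℝ (StrongDual ℝ X), Tendsto (fun n => F (u n)) atTop (𝓝 0)

section General

variable {X Y : Type*} [NormedAddCommGroup X] [NormedSpace ℝ X] [NormedAddCommGroup Y]
  [NormedSpace ℝ Y]

theorem tendsto_toWeakDual_iff {u : ℕ → StrongDual ℝ X} {f : StrongDual ℝ X} :
    Tendsto (fun n => StrongDual.toWeakDual (u n)) atTop (𝓝 (StrongDual.toWeakDual f)) ↔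
      ∀ x, Tendsto (fun n => u n x) atTop (𝓝 (f x)) :=
  tendsto_iff_forall_eval_tendsto_topDualPairing

theorem tendsto_toWeakSpace_iff {u : ℕ → StrongDual ℝ X} {f : StrongDual ℝ X} :
    Tendsto (fun n => toWeakSpace ℝ (StrongDual ℝ X) (u n)) atTop
        (𝓝 (toWeakSpace ℝ (StrongDual ℝ X) f)) ↔
      ∀ F : StrongDual ℝ (StrongDual ℝ X), Tendsto (fun n => F (u n)) atTop (𝓝 (F f)) := by
  refine WeakBilin.tendsto_iff_forall_eval_tendsto _ ?_
  intro x y h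
  refine SeparatingDual.eq_iff_forall_dual_eq (R := ℝ) |>.2 fun g => ?_
  exact LinearMap.congr_fun h g

theorem isGrothendieck_of_weakStarNullIsWeaklyNull (h : WeakStarNullIsWeaklyNull X) :
    IsGrothendieck X := by
  intro u f
  rw [tendsto_toWeakDual_iff, tendsto_toWeakSpace_iff]
  constructor
  · intro hu F
    have := h (fun n => u n - f) (fun x => by simpa using (hu x).sub_const (f x)) F
    simpa using this.add_const (F f)
  · intro hu x
    exact hu (NormedSpace.inclusionInDoubleDual ℝ X x)

theorem WeakStarNullIsWeaklyNull.of_equiv (e : X ≃L[ℝ] Y) (h : WeakStarNullIsWeaklyNull Y) :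
    WeakStarNullIsWeaklyNull X := by
  intro u hu F
  have := h (fun n => (u n).comp (e.symm : Y →L[ℝ] X)) (fun y => hu (e.symm y))
    (F.comp (ContinuousLinearMap.precomp ℝ (e : X →L[ℝ] Y)))
  convert this using 2 with n
  simp only [ContinuousLinearMap.comp_apply]
  congr 1
  ext x
  simp

/-- A point of the unit ball of the bidual is approximated by points of the unit ball of the space
on any finite set of functionals. -/
theorem exists_norm_le_one_forall_abs_sub_le {ι : Type*} [Fintype ι] (u : ι → StrongDual ℝ X)
    {F : StrongDual ℝ (StrongDual ℝ X)} (hF : ‖F‖ ≤ 1) {η : ℝ} (hη : 0 < η) :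
    ∃ x : X, ‖x‖ ≤ 1 ∧ ∀ i, |u i x - F (u i)| ≤ η := by
  classical
  set T : X →L[ℝ] (ι → ℝ) := ContinuousLinearMap.pi u
  set S : Set (ι → ℝ) := T '' Metric.closedBall 0 1 with hS
  have hconv : Convex ℝ (closure S) :=
    ((convex_closedBall (0 : X) 1).linear_image T.toLinearMap).closure
  by_cases hp : (fun i => F (u i)) ∈ closure S
  · obtain ⟨_, ⟨x, hx, rfl⟩, hd⟩ := Metric.mem_closure_iff.1 hp η hη
    refine ⟨x, by simpa using hx, fun i => ?_⟩
    have := (dist_le_pi_dist _ _ i).trans hd.le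
    rwa [dist_comm, Real.dist_eq] at this
  · exfalso
    obtain ⟨f, s, hs, hsp⟩ := geometric_hahn_banach_closed_point hconv isClosed_closure hp
    have hs' : ∀ x : X, ‖x‖ ≤ 1 → f (T x) < s := fun x hx =>
      hs _ (subset_closure ⟨x, by simpa using hx, rfl⟩)
    have hs0 : 0 ≤ s := by simpa using (hs' 0 (by simp)).le
    have hnorm : ‖f.comp T‖ ≤ s := by
      refine ContinuousLinearMap.opNorm_le_of_unit_norm hs0 fun x hx => ?_
      rw [Real.norm_eq_abs, abs_le]
      have h1 := hs' x hx.le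
      have h2 := hs' (-x) (by simp [hx])
      simp only [map_neg] at h2
      exact ⟨by simp only [ContinuousLinearMap.comp_apply]; linarith, h1.le⟩
    have hf : ∀ y : ι → ℝ, f y = ∑ i, y i * f (Pi.single i 1) := fun y => by
      conv_lhs => rw [pi_eq_sum_univ' y, map_sum]
      refine Finset.sum_congr rfl fun i _ => ?_
      rw [map_smul, smul_eq_mul]
    have hfT : f.comp T = ∑ i, f (Pi.single i 1) • u i := by
      ext x
      rw [ContinuousLinearMap.comp_apply, hf (T x)]
      simp [T, mul_comm]
    have hFf : F (f.comp T) = f fun i => F (u i) := by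
      rw [hfT, hf]
      simp [mul_comm]
    have : F (f.comp T) ≤ s :=
      (le_abs_self _).trans ((F.le_of_opNorm_le hF _).trans (by simpa using hnorm))
    linarith

/-! ### Projections of `ℓ_2` type -/

/-- A continuous projection `P` whose range and kernel form an `ℓ_2`-direct sum. -/
structure IsL2Projection (P : X →L[ℝ] X) : Prop where
  idem : ∀ x, P (P x) = P x
  norm_sq : ∀ x, ‖x‖ ^ 2 = ‖P x‖ ^ 2 + ‖x - P x‖ ^ 2

theorem IsL2Projection.norm_apply_le {P : X →L[ℝ] X} (h : IsL2Projection P) (x : X) :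
    ‖P x‖ ≤ ‖x‖ := by
  refine le_of_sq_le_sq ?_ (norm_nonneg _)
  rw [h.norm_sq x]
  nlinarith [sq_nonneg ‖x - P x‖]

theorem exists_norm_le_one_lt_apply (φ : StrongDual ℝ X) {r : ℝ} (hr : r < ‖φ‖) :
    ∃ x, ‖x‖ ≤ 1 ∧ r < φ x := by
  obtain ⟨x, hx, hr⟩ := φ.exists_lt_apply_of_lt_opNorm hr
  rcases le_total 0 (φ x) with h | h
  · exact ⟨x, hx.le, by rwa [Real.norm_of_nonneg h] at hr⟩
  · exact ⟨-x, by simpa using hx.le, by rw [Real.norm_of_nonpos h] at hr; simpa using hr⟩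

/-- The adjoint of an `ℓ_2`-projection is an `ℓ_2`-projection. -/
theorem IsL2Projection.precomp {P : X →L[ℝ] X} (h : IsL2Projection P) :
    IsL2Projection (ContinuousLinearMap.precomp ℝ P : StrongDual ℝ X →L[ℝ] StrongDual ℝ X) := by
  refine ⟨fun φ => ?_, fun φ => le_antisymm ?_ ?_⟩
  · ext x
    simp [h.idem]
  · set a := ‖ContinuousLinearMap.precomp ℝ P φ‖
    set b := ‖φ - ContinuousLinearMap.precomp ℝ P φ‖
    have key : ‖φ‖ ≤ √(a ^ 2 + b ^ 2) := by
      refine φ.opNorm_le_bound (Real.sqrt_nonneg _) fun x => ?_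
      have h1 : ‖φ (P x)‖ ≤ a * ‖P x‖ := by
        have : ‖ContinuousLinearMap.precomp ℝ P φ (P x)‖ ≤ a * ‖P x‖ :=
          ContinuousLinearMap.le_opNorm _ _
        rwa [show ContinuousLinearMap.precomp ℝ P φ (P x) = φ (P x) by simp [h.idem]] at this
      have h2 : ‖φ (x - P x)‖ ≤ b * ‖x - P x‖ := by
        have : ‖(φ - ContinuousLinearMap.precomp ℝ P φ) (x - P x)‖ ≤ b * ‖x - P x‖ :=
          ContinuousLinearMap.le_opNorm _ _
        rwa [show (φ - ContinuousLinearMap.precomp ℝ P φ) (x - P x) = φ (x - P x) by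
          simp [h.idem]] at this
      have h3 : ‖φ x‖ ≤ a * ‖P x‖ + b * ‖x - P x‖ := by
        calc ‖φ x‖ = ‖φ (P x) + φ (x - P x)‖ := by rw [← map_add]; simp
          _ ≤ _ := (norm_add_le _ _).trans (add_le_add h1 h2)
      refine h3.trans ?_
      rw [← Real.sqrt_sq (norm_nonneg x), ← Real.sqrt_mul (by positivity), h.norm_sq x]
      refine Real.le_sqrt_of_sq_le ?_
      nlinarith [sq_nonneg (a * ‖x - P x‖ - b * ‖P x‖)]
    calc ‖φ‖ ^ 2 ≤ √(a ^ 2 + b ^ 2) ^ 2 := by gcongr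
      _ = _ := Real.sq_sqrt (by positivity)
  · set ψ := ContinuousLinearMap.precomp ℝ P φ with hψ
    -- Test `φ` on `‖ψ‖ • P x + ‖φ - ψ‖ • (y - P y)` with `x`, `y` almost norming.
    set a := ‖ψ‖
    set b := ‖φ - ψ‖
    have ha : 0 ≤ a := norm_nonneg _
    have hb : 0 ≤ b := norm_nonneg _
    have key : ∀ ε > 0, a ^ 2 + b ^ 2 ≤ ‖φ‖ * √(a ^ 2 + b ^ 2) + ε * (a + b) := by
      intro ε hε
      obtain ⟨x, hx, hxa⟩ := exists_norm_le_one_lt_apply ψ (sub_lt_self a hε)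
      obtain ⟨y, hy, hyb⟩ := exists_norm_le_one_lt_apply (φ - ψ) (sub_lt_self b hε)
      set z := a • P x + b • (y - P y) with hz
      have hPz : P z = a • P x := by simp [hz, h.idem]
      have hzP : z - P z = b • (y - P y) := by rw [hPz, hz]; simp
      have hxP : ‖P x‖ ≤ 1 := (h.norm_apply_le x).trans hx
      have hyP : ‖y - P y‖ ^ 2 ≤ 1 := by
        have := h.norm_sq y
        nlinarith [sq_nonneg ‖P y‖, norm_nonneg y]
      have hzn : ‖z‖ ≤ √(a ^ 2 + b ^ 2) := by
        refine Real.le_sqrt_of_sq_le ?_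
        rw [h.norm_sq z, hzP, hPz, norm_smul, norm_smul, mul_pow, mul_pow, Real.norm_of_nonneg ha,
          Real.norm_of_nonneg hb]
        have : ‖P x‖ ^ 2 ≤ 1 := by nlinarith [norm_nonneg (P x)]
        nlinarith [sq_nonneg a, sq_nonneg b]
      have h1 : φ z = a * ψ x + b * (φ - ψ) y := by
        simp [hz, hψ]
      have h2 : φ z ≤ ‖φ‖ * √(a ^ 2 + b ^ 2) :=
        (le_abs_self _).trans ((φ.le_opNorm z).trans (by gcongr))
      nlinarith
    have key' : a ^ 2 + b ^ 2 ≤ ‖φ‖ * √(a ^ 2 + b ^ 2) := by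
      refine le_of_forall_pos_le_add fun ε hε => ?_
      have := key (ε / (a + b + 1)) (by positivity)
      refine this.trans ?_
      gcongr
      rw [div_mul_eq_mul_div, div_le_iff₀ (by positivity)]
      nlinarith
    have hs := Real.sq_sqrt (by positivity : (0:ℝ) ≤ a ^ 2 + b ^ 2)
    set s := √(a ^ 2 + b ^ 2)
    have hs0 : 0 ≤ s := Real.sqrt_nonneg _
    rw [← hs] at key' ⊢
    nlinarith [norm_nonneg φ, sq_nonneg (‖φ‖ - s)]

/-- If commuting `ℓ_2`-projections increase along a directed set, then their values at a point form
a Cauchy net: the square norms increase, and the square norm of a difference is the difference of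
the square norms. -/
theorem cauchySeq_of_isL2Projection {ι : Type*} [SemilatticeSup ι] [Nonempty ι]
    {P : ι → X →L[ℝ] X} (hP : ∀ i, IsL2Projection (P i))
    (hcomp : ∀ i j, i ≤ j → ∀ x, P i (P j x) = P i x) (x : X) :
    CauchySeq fun i => P i x := by
  have hmono : ∀ i j, i ≤ j → ‖P j x‖ ^ 2 = ‖P i x‖ ^ 2 + ‖P j x - P i x‖ ^ 2 := by
    intro i j hij
    rw [(hP i).norm_sq (P j x), hcomp i j hij]
  have hbdd : BddAbove (Set.range fun i => ‖P i x‖ ^ 2) := by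
    refine ⟨‖x‖ ^ 2, ?_⟩
    rintro _ ⟨i, rfl⟩
    have := (hP i).norm_apply_le x
    dsimp only
    gcongr
  rw [Metric.cauchySeq_iff']
  intro ε hε
  obtain ⟨i, hi⟩ := exists_lt_of_lt_ciSup
    (sub_lt_self (⨆ i, ‖P i x‖ ^ 2) (pow_pos hε 2))
  refine ⟨i, fun j hij => ?_⟩
  have h1 := le_ciSup hbdd j
  have h2 := hmono i j hij
  rw [dist_eq_norm]
  refine lt_of_pow_lt_pow_left₀ 2 hε.le ?_
  linarith

end General

/-! ### The `ℓ_2`-sum -/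

section LTwoSum

variable {ι : Type*} {E : ι → Type*} [∀ i, NormedAddCommGroup (E i)] [∀ i, NormedSpace ℝ (E i)]

/-- The projection of an `ℓ_2`-sum onto the sum of finitely many of its summands. -/
def lpTruncate [DecidableEq ι] (s : Finset ι) : lp E 2 →L[ℝ] lp E 2 :=
  ∑ i ∈ s, (lp.singleContinuousLinearMap ℝ E 2 i).comp (lp.evalCLM ℝ E 2 i)

variable [DecidableEq ι]

theorem lpTruncate_apply (s : Finset ι) (x : lp E 2) :
    lpTruncate s x = ∑ i ∈ s, lp.single 2 i (x i) := by
  simp [lpTruncate]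
  rfl

theorem lpTruncate_coord (s : Finset ι) (x : lp E 2) (i : ι) :
    lpTruncate s x i = if i ∈ s then x i else 0 := by
  rw [lpTruncate_apply, lp.coeFn_sum, Finset.sum_apply]
  simp only [lp.coeFn_single, Finset.sum_pi_single]

theorem lpTruncate_lpTruncate {s t : Finset ι} (h : s ⊆ t) (x : lp E 2) :
    lpTruncate s (lpTruncate t x) = lpTruncate s x ∧
      lpTruncate t (lpTruncate s x) = lpTruncate s x := by
  constructor <;> ext i <;> simp only [lpTruncate_coord]
  · by_cases hs : i ∈ s
    · simp [hs, h hs]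
    · simp [hs]
  · by_cases hs : i ∈ s <;> simp [hs]
    intro ht
    exact absurd (h hs) ht

theorem isL2Projection_lpTruncate (s : Finset ι) : IsL2Projection (lpTruncate (E := E) s) := by
  refine ⟨fun x => (lpTruncate_lpTruncate subset_rfl x).1, fun x => ?_⟩
  have h2 : (2 : ℝ≥0∞).toReal = (2 : ℕ) := by simp
  have h := lp.norm_sub_norm_compl_sub_single (p := 2) (E := E) (by simp) x s
  have h' := lp.norm_sum_single (p := 2) (E := E) (by simp) x s
  rw [← lpTruncate_apply] at h h'
  rw [h2] at h h'
  simp only [Real.rpow_natCast] at h h'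
  linarith

theorem tendsto_lpTruncate (x : lp E 2) :
    Tendsto (fun s : Finset ι => lpTruncate s x) atTop (𝓝 x) := by
  have := lp.hasSum_single (E := E) (p := 2) (by simp) x
  simp only [lpTruncate_apply]
  exact this

theorem tendsto_precomp_lpTruncate (φ : StrongDual ℝ (lp E 2)) :
    Tendsto (fun s : Finset ι => ContinuousLinearMap.precomp ℝ (lpTruncate s) φ) atTop (𝓝 φ) := by
  have hc := cauchySeq_of_isL2Projection (fun s => (isL2Projection_lpTruncate (E := E) s).precomp)
    (fun s t hst φ => by ext1 x; simp [(lpTruncate_lpTruncate hst x).2]) φ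
  obtain ⟨ψ, hψ⟩ := cauchySeq_tendsto_of_complete hc
  suffices ψ = φ by rwa [this] at hψ
  ext1 x
  have h1 : Tendsto (fun s : Finset ι => φ (lpTruncate s x)) atTop (𝓝 (ψ x)) :=
    ((NormedSpace.inclusionInDoubleDual ℝ _ x).continuous.tendsto ψ).comp hψ
  exact tendsto_nhds_unique h1 ((φ.continuous.tendsto x).comp (tendsto_lpTruncate x))

theorem tendsto_norm_precomp_precomp_lpTruncate_sub
    (F : StrongDual ℝ (StrongDual ℝ (lp E 2))) :
    Tendsto (fun s : Finset ι => ‖ContinuousLinearMap.precomp ℝ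
      (ContinuousLinearMap.precomp ℝ (lpTruncate s) :
        StrongDual ℝ (lp E 2) →L[ℝ] StrongDual ℝ (lp E 2)) F - F‖) atTop (𝓝 0) := by
  have hc := cauchySeq_of_isL2Projection
    (fun s => (isL2Projection_lpTruncate (E := E) s).precomp.precomp)
    (fun s t hst F => by
      ext1 φ
      simp only [ContinuousLinearMap.precomp_apply, ContinuousLinearMap.comp_apply]
      congr 1
      ext1 x
      simp [(lpTruncate_lpTruncate hst x).1]) F
  obtain ⟨G, hG⟩ := cauchySeq_tendsto_of_complete hc
  suffices G = F by
    rw [this] at hG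
    exact tendsto_iff_norm_sub_tendsto_zero.1 hG
  ext1 φ
  have h1 := ((NormedSpace.inclusionInDoubleDual ℝ _ φ).continuous.tendsto G).comp hG
  exact tendsto_nhds_unique h1 ((F.continuous.tendsto φ).comp (tendsto_precomp_lpTruncate φ))

/-- The `ℓ_2`-sum inherits the property from its summands: in the bidual of the sum, every element
is the norm limit of its truncations to finitely many summands, and on those the property of the
summands applies. -/
theorem WeakStarNullIsWeaklyNull.lp_two [∀ i, CompleteSpace (E i)]
    (h : ∀ i, WeakStarNullIsWeaklyNull (E i)) : WeakStarNullIsWeaklyNull (lp E 2) := by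
  intro u hu F
  obtain ⟨M, hM⟩ := banach_steinhaus (g := u) fun x => by
    obtain ⟨C, hC⟩ := (hu x).norm.bddAbove_range
    exact ⟨C, fun n => hC ⟨n, rfl⟩⟩
  have hfin : ∀ s : Finset ι,
      Tendsto (fun n => F (ContinuousLinearMap.precomp ℝ (lpTruncate s) (u n))) atTop (𝓝 0) := by
    intro s
    have hi : ∀ i ∈ s, Tendsto (fun n => F (((u n).comp (lp.singleContinuousLinearMap ℝ E 2 i)).comp
        (lp.evalCLM ℝ E 2 i))) atTop (𝓝 0) := fun i _ =>
      h i (fun n => (u n).comp (lp.singleContinuousLinearMap ℝ E 2 i)) (fun x => hu _)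
        (F.comp (ContinuousLinearMap.precomp ℝ (lp.evalCLM ℝ E 2 i)))
    have := tendsto_finsetSum s hi
    simp only [Finset.sum_const_zero] at this
    convert this using 2 with n
    rw [← map_sum]
    congr 1
    ext1 x
    simp [lpTruncate, map_sum]
  refine Metric.tendsto_atTop'.2 fun ε hε => ?_
  have hM0 : 0 ≤ M := (norm_nonneg _).trans (hM 0)
  obtain ⟨s, hs⟩ := ((tendsto_norm_precomp_precomp_lpTruncate_sub F).eventually_lt_const
      (by positivity : 0 < ε / (2 * (M + 1)))).exists
  obtain ⟨N, hN⟩ := Metric.tendsto_atTop'.1 (hfin s) (ε / 2) (by positivity)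
  refine ⟨N, fun n hn => ?_⟩
  have h1 := hN n hn
  rw [dist_zero_right] at h1 ⊢
  set G := ContinuousLinearMap.precomp ℝ (ContinuousLinearMap.precomp ℝ (lpTruncate s) :
        StrongDual ℝ (lp E 2) →L[ℝ] StrongDual ℝ (lp E 2)) F with hG
  have h2 : ‖(G - F) (u n)‖ ≤ ε / (2 * (M + 1)) * M :=
    ((G - F).le_opNorm _).trans (mul_le_mul hs.le (hM n) (norm_nonneg _) (by positivity))
  have h3 : ε / (2 * (M + 1)) * M ≤ ε / 2 := by
    rw [div_mul_eq_mul_div, div_le_div_iff₀ (by positivity) (by positivity)]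
    nlinarith
  have h4 : F (u n) = F (ContinuousLinearMap.precomp ℝ (lpTruncate s) (u n)) - (G - F) (u n) := by
    simp [hG]
  rw [h4]
  refine (norm_sub_le _ _).trans_lt ?_
  linarith

end LTwoSum

/-! ### Finitely additive set functions and Rosenthal's lemma -/

/-- A nonnegative finitely additive set function, defined on all subsets of `α`. Being real-valued, it
is bounded by its total mass. -/
structure IsPosCharge {α : Type*} (m : Set α → ℝ) : Prop where
  nonneg : ∀ S, 0 ≤ m S
  union : ∀ S T, Disjoint S T → m (S ∪ T) = m S + m T

namespace IsPosCharge

variable {α : Type*} {m : Set α → ℝ}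

theorem empty (h : IsPosCharge m) : m ∅ = 0 := by
  simpa using h.union ∅ ∅ (by simp)

theorem eq_add_diff (h : IsPosCharge m) {S T : Set α} (hST : S ⊆ T) :
    m T = m S + m (T \ S) := by
  rw [← h.union _ _ Set.disjoint_sdiff_right, Set.union_sdiff_cancel hST]

theorem mono (h : IsPosCharge m) {S T : Set α} (hST : S ⊆ T) : m S ≤ m T := by
  linarith [h.eq_add_diff hST, h.nonneg (T \ S)]

theorem union_le (h : IsPosCharge m) (S T : Set α) : m (S ∪ T) ≤ m S + m T := by
  rw [← Set.union_sdiff_self, h.union _ _ Set.disjoint_sdiff_right]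
  linarith [h.mono (Set.sdiff_subset : T \ S ⊆ T)]

theorem biUnion_le (h : IsPosCharge m) {β : Type*} (t : Finset β) (A : β → Set α) :
    m (⋃ i ∈ t, A i) ≤ ∑ i ∈ t, m (A i) := by
  classical
  induction t using Finset.induction_on with
  | empty => simp [h.empty]
  | insert a t ha ih =>
    rw [Finset.set_biUnion_insert, Finset.sum_insert ha]
    exact (h.union_le _ _).trans (by linarith)

theorem sum_eq (h : IsPosCharge m) {β : Type*} (t : Finset β) {A : β → Set α}
    (hA : Pairwise (Function.onFun Disjoint A)) : ∑ i ∈ t, m (A i) = m (⋃ i ∈ t, A i) := by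
  classical
  induction t using Finset.induction_on with
  | empty => simp [h.empty]
  | insert a t ha ih =>
    rw [Finset.set_biUnion_insert, Finset.sum_insert ha, ih, h.union]
    rw [Set.disjoint_iUnion₂_right]
    intro i hi
    exact hA (by rintro rfl; exact ha hi)

theorem preimage_biUnion (h : IsPosCharge m) {β : Type*} {A : β → Set α}
    (hA : Pairwise (Function.onFun Disjoint A)) :
    IsPosCharge fun T : Set β => m (⋃ i ∈ T, A i) := by
  refine ⟨fun T => h.nonneg _, fun S T hST => ?_⟩
  rw [Set.biUnion_union, h.union]
  rw [Set.disjoint_iUnion₂_left]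
  intro i hi
  rw [Set.disjoint_iUnion₂_right]
  intro j hj
  exact hA (by rintro rfl; exact Set.disjoint_left.1 hST hi hj)

theorem image (h : IsPosCharge m) {β : Type*} {f : β → α} (hf : Function.Injective f) :
    IsPosCharge fun T : Set β => m (f '' T) :=
  ⟨fun T => h.nonneg _, fun S T hST => by
    rw [Set.image_union, h.union _ _ ((Set.disjoint_image_iff hf).2 hST)]⟩

end IsPosCharge

/-- **Rosenthal's disjointification lemma**: for uniformly bounded charges `m k` on `ℕ`, there is
an infinite set on which each `m k` is small off the point `k`. -/
theorem exists_injective_forall_image_compl_lt {m : ℕ → Set ℕ → ℝ} (hm : ∀ k, IsPosCharge (m k))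
    {C : ℝ} (hC : ∀ k, m k Set.univ ≤ C) {ε : ℝ} (hε : 0 < ε) :
    ∃ g : ℕ → ℕ, Function.Injective g ∧ ∀ j, m (g j) (g '' {j}ᶜ) < ε := by
  obtain ⟨n, hn⟩ := exists_nat_gt (C / ε)
  have hCn : ∀ k, m k Set.univ < n * ε := fun k =>
    (hC k).trans_lt ((div_lt_iff₀ hε).1 hn)
  clear hn hC
  induction n generalizing m with
  | zero => exact absurd (hCn 0) (by simpa using (hm 0).nonneg _)
  | succ n ih =>
    -- Split `ℕ` into the infinitely many rows `Nat.pair p ·`. Either one of the rows will do, or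
    -- a point can be picked from each row so that the total masses on the picked points drop by `ε`.
    by_cases hrow : ∃ p, ∀ i, m (Nat.pair p i) (Nat.pair p '' {i}ᶜ) < ε
    · obtain ⟨p, hp⟩ := hrow
      exact ⟨Nat.pair p, fun i j hij => (Nat.pair_eq_pair.1 hij).2, hp⟩
    · push Not at hrow
      choose i hi using hrow
      set h : ℕ → ℕ := fun p => Nat.pair p (i p) with hdef
      have hinj : Function.Injective h := fun p q hpq => (Nat.pair_eq_pair.1 hpq).1
      obtain ⟨g, hg, hgm⟩ := ih (m := fun p T => m (h p) (h '' T))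
        (fun p => (hm _).image hinj) (fun p => by
          have hdisj : Disjoint (h '' Set.univ) (Nat.pair p '' {i p}ᶜ) := by
            rw [Set.disjoint_left]
            rintro _ ⟨q, -, rfl⟩ ⟨j, hj, hq⟩
            obtain ⟨rfl, rfl⟩ := Nat.pair_eq_pair.1 hq
            exact hj rfl
          have h1 := (hm (h p)).union _ _ hdisj
          have h2 := (hm (h p)).mono (Set.subset_univ (h '' Set.univ ∪ Nat.pair p '' {i p}ᶜ))
          have h3 := hCn (h p)
          have h4 := hi p
          push_cast at h3
          linarith)
      refine ⟨h ∘ g, hinj.comp hg, fun j => ?_⟩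
      rw [Set.image_comp]
      exact hgm j

/-- A family of charges is uniformly exhaustive if along every disjoint sequence of sets it becomes
uniformly small. (A single small term is asked for; it applies to subsequences.) -/
def UniformlyExhaustive {α : Type*} (m : ℕ → Set α → ℝ) : Prop :=
  ∀ A : ℕ → Set α, Pairwise (Function.onFun Disjoint A) → ∀ ε > 0, ∃ j, ∀ k, m k (A j) < ε

/-! ### The variation of a functional on `ℓ_∞` -/

/-- The Banach algebra `ℓ_∞(ι)`. -/
abbrev LInfty (ι : Type*) : Type _ := lp (fun _ : ι => ℝ) ∞

namespace LInfty

variable {ι : Type*}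

theorem norm_le {x : LInfty ι} {C : ℝ} (hC : 0 ≤ C) (h : ∀ i, |x i| ≤ C) : ‖x‖ ≤ C :=
  lp.norm_le_of_forall_le hC h

theorem abs_apply_le (x : LInfty ι) (i : ι) : |x i| ≤ ‖x‖ :=
  lp.norm_apply_le_norm ENNReal.top_ne_zero x i

/-- A bounded family of reals as an element of `ℓ_∞`. -/
def ofBounded (f : ι → ℝ) (C : ℝ) (h : ∀ i, |f i| ≤ C) : LInfty ι :=
  ⟨f, memℓp_infty ⟨C, by rintro _ ⟨i, rfl⟩; exact h i⟩⟩

@[simp]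
theorem ofBounded_apply (f : ι → ℝ) (C : ℝ) (h : ∀ i, |f i| ≤ C) (i : ι) :
    ofBounded f C h i = f i := rfl

open Classical in
/-- The indicator of a set, as an idempotent of `ℓ_∞`. -/
def ind (S : Set ι) : LInfty ι :=
  ofBounded (fun i => if i ∈ S then 1 else 0) 1 fun i => by split_ifs <;> simp

open Classical in
theorem ind_apply (S : Set ι) (i : ι) : ind S i = if i ∈ S then 1 else 0 := rfl

theorem mul_apply (x y : LInfty ι) (i : ι) : (x * y) i = x i * y i := rfl

open Classical in
theorem ind_mul_apply (S : Set ι) (x : LInfty ι) (i : ι) :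
    (ind S * x) i = if i ∈ S then x i else 0 := by
  rw [mul_apply, ind_apply]
  split_ifs <;> simp

theorem ind_mul_ind_mul (S : Set ι) (x : LInfty ι) : ind S * (ind S * x) = ind S * x := by
  ext i
  simp only [ind_mul_apply]
  split_ifs <;> rfl

theorem ind_union_mul {S T : Set ι} (h : Disjoint S T) (x : LInfty ι) :
    ind (S ∪ T) * x = ind S * x + ind T * x := by
  ext i
  have : i ∈ S → i ∉ T := fun hi => Set.disjoint_left.1 h hi
  simp only [lp.coeFn_add, Pi.add_apply, ind_mul_apply, Set.mem_union]
  by_cases h1 : i ∈ S <;> by_cases h2 : i ∈ T <;> simp_all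

@[simp]
theorem ind_univ_mul (x : LInfty ι) : ind Set.univ * x = x := by
  ext i
  simp [ind_mul_apply]

/-- The variation `|u|(S)` of a functional `u` on `ℓ_∞` over a set `S` of coordinates: the norm of
the restriction of `u` to the elements supported in `S`. -/
def variation (u : StrongDual ℝ (LInfty ι)) (S : Set ι) : ℝ :=
  ‖u.comp (ContinuousLinearMap.mul ℝ (LInfty ι) (ind S))‖

theorem abs_apply_ind_mul_le (u : StrongDual ℝ (LInfty ι)) (S : Set ι) (x : LInfty ι) :
    |u (ind S * x)| ≤ variation u S * ‖x‖ :=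
  (u.comp (ContinuousLinearMap.mul ℝ (LInfty ι) (ind S))).le_opNorm x

theorem variation_le {u : StrongDual ℝ (LInfty ι)} {S : Set ι} {C : ℝ}
    (h : ∀ x : LInfty ι, ‖x‖ ≤ 1 → u (ind S * x) ≤ C) : variation u S ≤ C := by
  refine le_of_forall_lt fun r hr => ?_
  obtain ⟨x, hx, hxr⟩ := exists_norm_le_one_lt_apply _ hr
  exact hxr.trans_le (h x hx)

theorem exists_lt_apply_ind_mul {u : StrongDual ℝ (LInfty ι)} {S : Set ι} {r : ℝ}
    (hr : r < variation u S) : ∃ x : LInfty ι, ‖x‖ ≤ 1 ∧ r < u (ind S * x) :=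
  exists_norm_le_one_lt_apply _ hr

theorem variation_univ (u : StrongDual ℝ (LInfty ι)) : variation u Set.univ = ‖u‖ := by
  rw [variation]
  congr 1
  ext x
  simp

theorem isPosCharge_variation (u : StrongDual ℝ (LInfty ι)) : IsPosCharge (variation u) := by
  refine ⟨fun S => norm_nonneg _, fun S T hST => le_antisymm ?_ ?_⟩
  · refine variation_le fun x hx => ?_
    rw [ind_union_mul hST, map_add]
    have h1 := (le_abs_self _).trans (abs_apply_ind_mul_le u S x)
    have h2 := (le_abs_self _).trans (abs_apply_ind_mul_le u T x)
    have h3 : 0 ≤ variation u S := norm_nonneg _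
    have h4 : 0 ≤ variation u T := norm_nonneg _
    nlinarith
  · refine le_of_forall_pos_sub_le fun ε hε => ?_
    obtain ⟨x, hx, hxr⟩ := exists_lt_apply_ind_mul (sub_lt_self (variation u S) (half_pos hε))
    obtain ⟨y, hy, hyr⟩ := exists_lt_apply_ind_mul (sub_lt_self (variation u T) (half_pos hε))
    set z := ind S * x + ind T * y with hz
    have hzS : ind (S ∪ T) * z = ind S * x + ind T * y := by
      ext i
      have : i ∈ S → i ∉ T := fun hi => Set.disjoint_left.1 hST hi
      simp only [hz, lp.coeFn_add, Pi.add_apply, ind_mul_apply, Set.mem_union]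
      by_cases h1 : i ∈ S <;> by_cases h2 : i ∈ T <;> simp_all
    have hzn : ‖z‖ ≤ 1 := by
      refine norm_le zero_le_one fun i => ?_
      have : i ∈ S → i ∉ T := fun hi => Set.disjoint_left.1 hST hi
      have hxi := (abs_apply_le x i).trans hx
      have hyi := (abs_apply_le y i).trans hy
      simp only [hz, lp.coeFn_add, Pi.add_apply, ind_mul_apply]
      by_cases h1 : i ∈ S <;> by_cases h2 : i ∈ T <;> simp_all
    have h1 := (le_abs_self _).trans (abs_apply_ind_mul_le u (S ∪ T) z)
    rw [hzS, map_add] at h1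
    have h2 : 0 ≤ variation u (S ∪ T) := norm_nonneg _
    nlinarith

/-- A gliding hump: were the variations of a weak*-null sequence not uniformly exhaustive, then
Rosenthal's lemma would give disjoint humps, the sum of which contradicts weak* convergence. -/
theorem uniformlyExhaustive_variation {u : ℕ → StrongDual ℝ (LInfty ι)} {M : ℝ}
    (hM : ∀ k, ‖u k‖ ≤ M) (hu : ∀ x, Tendsto (fun k => u k x) atTop (𝓝 0)) :
    UniformlyExhaustive fun k => variation (u k) := by
  classical
  intro A hA ε hε
  by_contra! hcon
  choose k hk using hcon
  have hx : ∀ j, ∃ x : LInfty ι, ‖x‖ ≤ 1 ∧ ε / 2 < u (k j) (ind (A j) * x) := fun j =>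
    exists_lt_apply_ind_mul ((half_lt_self hε).trans_le (hk j))
  choose x hx1 hxu using hx
  obtain ⟨g, hg, hgm⟩ := exists_injective_forall_image_compl_lt
    (m := fun j T => variation (u (k j)) (⋃ i ∈ T, A i))
    (fun j => (isPosCharge_variation _).preimage_biUnion hA) (C := M)
    (fun j => ((isPosCharge_variation _).mono (Set.subset_univ _)).trans
      ((variation_univ _).trans_le (hM _)))
    (show 0 < ε / 4 by positivity)
  -- `y` agrees with `x (g j)` on `A (g j)` and vanishes off the union of these sets.
  let y : LInfty ι := ofBounded
    (fun i => if h : ∃ j, i ∈ A (g j) then x (g h.choose) i else 0) 1 fun i => by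
      dsimp only
      split_ifs
      · exact (abs_apply_le _ _).trans (hx1 _)
      · simp
  have hy1 : ‖y‖ ≤ 1 := by
    refine norm_le zero_le_one fun i => ?_
    simp only [y, ofBounded_apply]
    split_ifs
    · exact (abs_apply_le _ _).trans (hx1 _)
    · simp
  have hyA : ∀ j, ∀ i ∈ A (g j), y i = x (g j) i := by
    intro j i hi
    have hex : ∃ j, i ∈ A (g j) := ⟨j, hi⟩
    have : hex.choose = j := by
      by_contra hne
      exact Set.disjoint_left.1 (hA (hg.ne hne)) hex.choose_spec hi
    simp only [y, ofBounded_apply, dif_pos hex, this]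
  have hy0 : ∀ i, (∀ j, i ∉ A (g j)) → y i = 0 := by
    intro i hi
    simp only [y, ofBounded_apply]
    rw [dif_neg]
    push Not
    exact hi
  have hlow : ∀ j, ε / 4 < u (k (g j)) y := by
    intro j
    have hsplit : y = ind (A (g j)) * x (g j) + ind (⋃ i ∈ g '' {j}ᶜ, A i) * y := by
      ext i
      simp only [lp.coeFn_add, Pi.add_apply, ind_mul_apply]
      by_cases h1 : i ∈ A (g j)
      · have h2 : i ∉ ⋃ i ∈ g '' {j}ᶜ, A i := by
          simp only [Set.mem_iUnion, not_exists]
          rintro _ ⟨l, hl, rfl⟩ hil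
          exact Set.disjoint_left.1 (hA (hg.ne hl)) hil h1
        rw [if_pos h1, if_neg h2, hyA j i h1, add_zero]
      · rw [if_neg h1, zero_add]
        split_ifs with h2
        · rfl
        · refine hy0 i fun l hl => h2 ?_
          refine Set.mem_biUnion (Set.mem_image_of_mem g (?_ : l ∈ {j}ᶜ)) hl
          rintro rfl
          exact h1 hl
    have h1 := abs_apply_ind_mul_le (u (k (g j))) (⋃ i ∈ g '' {j}ᶜ, A i) y
    have h2 := hgm j
    have h3 := hxu (g j)
    have h4 : 0 ≤ variation (u (k (g j))) (⋃ i ∈ g '' {j}ᶜ, A i) := norm_nonneg _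
    have h5 := neg_le_of_abs_le h1
    have h6 : u (k (g j)) y = u (k (g j)) (ind (A (g j)) * x (g j)) +
        u (k (g j)) (ind (⋃ i ∈ g '' {j}ᶜ, A i) * y) := by
      rw [← map_add, ← hsplit]
    nlinarith
  obtain ⟨N, hN⟩ := Metric.tendsto_atTop.1 (hu y) (ε / 4) (by positivity)
  have hkN : ∀ j, k (g j) < N := by
    intro j
    by_contra! hj
    have := hN _ hj
    rw [dist_zero_right, Real.norm_eq_abs] at this
    linarith [hlow j, le_abs_self (u (k (g j)) y)]
  -- Infinitely many of the humps belong to one functional, which therefore is unbounded.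
  obtain ⟨k₀, hk₀⟩ := Finite.exists_infinite_fiber fun j => (⟨k (g j), hkN j⟩ : Fin N)
  obtain ⟨n, hn⟩ := exists_nat_gt (M / ε)
  obtain ⟨t, ht, htn⟩ := (Set.infinite_coe_iff.1 hk₀).exists_subset_card_eq n
  have h1 : ∑ j ∈ t, variation (u k₀) (A (g j)) ≤ M := by
    rw [(isPosCharge_variation _).sum_eq t (A := fun j => A (g j))
      fun i j hij => hA (hg.ne hij)]
    exact ((isPosCharge_variation _).mono (Set.subset_univ _)).trans
      ((variation_univ _).trans_le (hM _))
  have h2 : (n : ℝ) * ε ≤ ∑ j ∈ t, variation (u k₀) (A (g j)) := by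
    rw [← htn, ← nsmul_eq_mul]
    refine Finset.card_nsmul_le_sum _ _ _ fun j hj => ?_
    have : k (g j) = k₀ := congrArg Fin.val (ht hj)
    rw [← this]
    exact hk _
  rw [div_lt_iff₀ hε] at hn
  linarith

end LInfty

/-! ### Uniform absolute continuity -/

namespace UniformlyExhaustive

variable {α : Type*} {m : ℕ → Set α → ℝ}

theorem exists_forall_diff_lt (hexh : UniformlyExhaustive m) {U : ℕ → Set α} (hU : Monotone U)
    {ε : ℝ} (hε : 0 < ε) : ∃ n, ∀ j ≥ n, ∀ k, m k (U j \ U n) < ε := by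
  by_contra! hcon
  choose j hj k hk using hcon
  set s : ℕ → ℕ := fun i => j^[i] 0 with hs
  have hs1 : ∀ i, s (i + 1) = j (s i) := fun i => Function.iterate_succ_apply' j i 0
  have hsm : Monotone s := monotone_nat_of_le_succ fun i => (hs1 i).symm ▸ hj (s i)
  obtain ⟨i, hi⟩ := hexh (fun i => U (s (i + 1)) \ U (s i)) (by
    refine (pairwise_disjoint_on _).2 fun a b hab => ?_
    refine Set.disjoint_left.2 fun x hxa hxb => hxb.2 ?_
    exact hU (hsm (Nat.succ_le_of_lt hab)) hxa.1) ε hε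
  have := hi (k (s i))
  rw [hs1] at this
  exact absurd (hk (s i)) (not_le.2 this)

theorem exists_forall_diff_lt_of_antitone (hexh : UniformlyExhaustive m) {G : ℕ → Set α}
    (hG : Antitone G) {ε : ℝ} (hε : 0 < ε) : ∃ n, ∀ j ≥ n, ∀ k, m k (G n \ G j) < ε := by
  obtain ⟨n, hn⟩ := hexh.exists_forall_diff_lt (U := fun i => (G i)ᶜ)
    (fun i j hij => Set.compl_subset_compl.2 (hG hij)) hε
  refine ⟨n, fun j hj k => ?_⟩
  have := hn j hj k
  rwa [show (G j)ᶜ \ (G n)ᶜ = G n \ G j by ext; simp [and_comm]] at this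

/-- A uniformly exhaustive sequence of charges is uniformly absolutely continuous with respect to
finitely many of its terms. Otherwise there would be sets `B N` on which the first `N` charges are
tiny while another one is at least `ε`. By exhaustivity, finite unions `E N` of the `B l`, `l ≥ N`,
exhaust all these `B l` up to small error, so that the decreasing sets `E 0 ∩ ⋯ ∩ E N` are still
large for some charges; by exhaustivity again, a single charge remains large on all of them. -/
theorem exists_forall_lt (hexh : UniformlyExhaustive m) (hm : ∀ k, IsPosCharge (m k)) {ε : ℝ}
    (hε : 0 < ε) : ∃ N : ℕ, ∃ δ > 0, ∀ S, (∀ i < N, m i S < δ) → ∀ k, m k S < ε := by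
  by_contra! hcon
  have hB : ∀ N : ℕ, ∃ S, (∀ i < N, m i S < (1 / 2 : ℝ) ^ N) ∧ ∃ k, ε ≤ m k S := fun N =>
    hcon N _ (by positivity)
  choose B hB κ hκ using hB
  have hmono : ∀ N, Monotone fun n => ⋃ l ∈ Finset.Ico N n, B l := fun N a b hab =>
    Set.iUnion₂_mono' fun l hl => ⟨l, Finset.Ico_subset_Ico_right hab hl, subset_rfl⟩
  have hν : ∀ N : ℕ, ∃ n, ∀ j ≥ n, ∀ k,
      m k ((⋃ l ∈ Finset.Ico N j, B l) \ ⋃ l ∈ Finset.Ico N n, B l) < ε / 4 * (1 / 2) ^ N :=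
    fun N => hexh.exists_forall_diff_lt (hmono N) (by positivity)
  choose ν hν using hν
  set E : ℕ → Set α := fun N => ⋃ l ∈ Finset.Ico N (ν N), B l with hE
  have hBE : ∀ N l, N ≤ l → ∀ k, m k (B l \ E N) ≤ ε / 4 * (1 / 2) ^ N := by
    intro N l hNl k
    refine ((hm k).mono (Set.sdiff_subset_sdiff_left ?_)).trans
      (hν N (max (ν N) (l + 1)) (le_max_left _ _) k).le
    refine Set.subset_biUnion_of_mem (u := B) ?_
    exact Finset.mem_Ico.2 ⟨hNl, lt_max_of_lt_right l.lt_succ_self⟩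
  set G : ℕ → Set α := fun N => ⋂ i ≤ N, E i with hG
  have hGanti : Antitone G := fun a b hab =>
    Set.biInter_subset_biInter_left fun i (hi : i ≤ a) => hi.trans hab
  have hGlarge : ∀ l, ε / 2 ≤ m (κ l) (G l) := by
    intro l
    have h1 : B l ⊆ (⋃ i ∈ Finset.range (l + 1), B l \ E i) ∪ G l := by
      intro x hx
      by_cases hxG : x ∈ G l
      · exact Or.inr hxG
      · left
        simp only [hG, Set.mem_iInter, not_forall] at hxG
        obtain ⟨i, hi, hxi⟩ := hxG
        exact Set.mem_biUnion (Finset.mem_range.2 (Nat.lt_succ_of_le hi)) ⟨hx, hxi⟩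
    have h2 := ((hm (κ l)).mono h1).trans ((hm (κ l)).union_le _ _)
    have h3 : m (κ l) (⋃ i ∈ Finset.range (l + 1), B l \ E i) ≤ ε / 2 := by
      refine ((hm _).biUnion_le _ _).trans ?_
      calc ∑ i ∈ Finset.range (l + 1), m (κ l) (B l \ E i)
          ≤ ∑ i ∈ Finset.range (l + 1), ε / 4 * (1 / 2) ^ i :=
            Finset.sum_le_sum fun i hi => hBE i l (Nat.le_of_lt_succ (Finset.mem_range.1 hi)) _
        _ = ε / 4 * ∑ i ∈ Finset.range (l + 1), (1 / 2) ^ i := by rw [Finset.mul_sum]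
        _ ≤ ε / 4 * 2 := by gcongr; exact sum_geometric_two_le _
        _ = ε / 2 := by ring
    linarith [hκ l]
  obtain ⟨N₀, hN₀⟩ := hexh.exists_forall_diff_lt_of_antitone hGanti (show 0 < ε / 4 by positivity)
  set k := κ N₀
  have hlow : ∀ j ≥ N₀, ε / 4 ≤ m k (G j) := fun j hj => by
    have h1 := (hm k).eq_add_diff (hGanti hj)
    linarith [hN₀ j hj k, hGlarge N₀]
  obtain ⟨n, hn⟩ := exists_pow_lt_of_lt_one (show 0 < ε / 8 by positivity)
    (show (1 / 2 : ℝ) < 1 by norm_num)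
  set j := max n (max N₀ (k + 1))
  have hkj : k < j := (Nat.lt_succ_self k).trans_le ((le_max_right _ _).trans (le_max_right _ _))
  have hup : m k (G j) ≤ 2 * (1 / 2) ^ j := by
    calc m k (G j) ≤ m k (E j) := (hm k).mono fun x hx => Set.mem_iInter₂.1 hx j le_rfl
      _ ≤ ∑ l ∈ Finset.Ico j (ν j), m k (B l) := (hm k).biUnion_le _ _
      _ ≤ ∑ l ∈ Finset.Ico j (ν j), (1 / 2) ^ l := Finset.sum_le_sum fun l hl =>
          (hB l k (hkj.trans_le (Finset.mem_Ico.1 hl).1)).le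
      _ = (1 / 2) ^ j * ∑ i ∈ Finset.range (ν j - j), (1 / 2) ^ i := by
          rw [Finset.sum_Ico_eq_sum_range, Finset.mul_sum]
          simp only [pow_add]
      _ ≤ (1 / 2) ^ j * 2 := by gcongr; exact sum_geometric_two_le _
      _ = _ := mul_comm _ _
  have hjn : (1 / 2 : ℝ) ^ j ≤ (1 / 2) ^ n :=
    pow_le_pow_of_le_one (by norm_num) (by norm_num) (le_max_left _ _)
  linarith [hlow j ((le_max_left _ _).trans (le_max_right _ _))]

end UniformlyExhaustive

/-! ### Grothendieck's theorem for `ℓ_∞` -/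

namespace LInfty

variable {ι : Type*}

/-- If `y` almost norms `u`, then the functional `z ↦ u (y * z)` is almost positive. -/
theorem neg_mul_le_apply_mul {u : StrongDual ℝ (LInfty ι)} {y : LInfty ι} (hy : ‖y‖ ≤ 1) {ε : ℝ}
    (hyu : ‖u‖ - ε ≤ u y) {z : LInfty ι} {c : ℝ} (hc : 0 ≤ c) (hz : ∀ i, 0 ≤ z i ∧ z i ≤ c) :
    -(c * ε) ≤ u (y * z) := by
  have hw : ‖c • y - (2 : ℝ) • (y * z)‖ ≤ c := by
    refine norm_le hc fun i => ?_
    have h1 : (c • y - (2 : ℝ) • (y * z)) i = y i * (c - 2 * z i) := by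
      simp only [lp.coeFn_sub, lp.coeFn_smul, Pi.sub_apply, Pi.smul_apply, smul_eq_mul, mul_apply]
      ring
    have h2 : |c - 2 * z i| ≤ c := by
      rw [abs_le]
      constructor <;> linarith [(hz i).1, (hz i).2]
    rw [h1, abs_mul]
    have h3 := (abs_apply_le y i).trans hy
    nlinarith [abs_nonneg (c - 2 * z i), abs_nonneg (y i)]
  have h1 : u (c • y - (2 : ℝ) • (y * z)) ≤ ‖u‖ * c :=
    (le_abs_self _).trans ((u.le_opNorm _).trans (by gcongr))
  rw [map_sub, map_smul, map_smul, smul_eq_mul, smul_eq_mul] at h1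
  have hε : 0 ≤ ε := by
    have : u y ≤ ‖u‖ * 1 := (le_abs_self _).trans ((u.le_opNorm _).trans (by gcongr))
    linarith
  nlinarith

theorem variation_sub_le_apply_mul_ind {u : StrongDual ℝ (LInfty ι)} {y : LInfty ι}
    (hy : ‖y‖ ≤ 1) {ε : ℝ} (hyu : ‖u‖ - ε ≤ u y) (S : Set ι) :
    variation u S - ε ≤ u (y * ind S) := by
  have h1 : u y = u (ind S * y) + u (ind Sᶜ * y) := by
    rw [← map_add, ← ind_union_mul disjoint_compl_right, Set.union_compl_self, ind_univ_mul]
  have h2 := (isPosCharge_variation u).union S Sᶜ disjoint_compl_right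
  rw [Set.union_compl_self, variation_univ] at h2
  have h3 := (le_abs_self _).trans (abs_apply_ind_mul_le u Sᶜ y)
  have h4 : 0 ≤ variation u Sᶜ := norm_nonneg _
  rw [mul_comm y]
  nlinarith

/-- Uniform control by an almost positive quadratic form: smallness of `L (x * x)` forces `x` to be
small off a set of small variation for all the functionals. -/
theorem exists_forall_apply_mul_self_le {u : ℕ → StrongDual ℝ (LInfty ι)} {M : ℝ}
    (hM : ∀ k, ‖u k‖ ≤ M) (hexh : UniformlyExhaustive fun k => variation (u k)) {ε : ℝ}
    (hε : 0 < ε) :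
    ∃ L : StrongDual ℝ (LInfty ι), ∃ η > 0, ∀ x : LInfty ι, ‖x‖ ≤ 2 → L (x * x) ≤ η →
      ∀ k, |u k x| ≤ ε := by
  have hM0 : 0 ≤ M := (norm_nonneg _).trans (hM 0)
  obtain ⟨N, δ, hδ, hN⟩ := hexh.exists_forall_lt (fun k => isPosCharge_variation _)
    (show 0 < ε / 4 by positivity)
  set τ : ℝ := ε / (2 * (M + 1)) with hτ
  have hτ0 : 0 < τ := by positivity
  -- `η` is so small that `(4 * N + 5) * η / τ ^ 2 + η < δ`.
  set K : ℝ := (4 * N + 5) / τ ^ 2 + 1 with hK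
  have hK0 : 0 < K := by positivity
  set η : ℝ := δ / (2 * K) with hη
  have hη0 : 0 < η := by positivity
  have hηK : η * K < δ := by
    rw [hη, div_mul_eq_mul_div, div_lt_iff₀ (by positivity)]
    nlinarith
  have hy : ∀ i, ∃ y : LInfty ι, ‖y‖ ≤ 1 ∧ ‖u i‖ - η < u i y := fun i =>
    exists_norm_le_one_lt_apply (u i) (sub_lt_self _ hη0)
  choose y hy1 hyu using hy
  refine ⟨∑ i ∈ Finset.range N, (u i).comp (ContinuousLinearMap.mul ℝ (LInfty ι) (y i)), η, hη0,
    fun x hx hLx k => ?_⟩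
  have hx2 : ∀ t, (x * x) t ≤ 4 := fun t => by
    have := (abs_apply_le x t).trans hx
    rw [mul_apply, ← abs_mul_abs_self]
    nlinarith [abs_nonneg (x t)]
  have hLx' : ∑ i ∈ Finset.range N, u i (y i * (x * x)) ≤ η := by
    simpa using hLx
  set A : Set ι := {t | τ < |x t|} with hA
  have hVA : ∀ i < N, variation (u i) A < δ := by
    intro i hi
    have hpos : ∀ j, -(4 * η) ≤ u j (y j * (x * x)) := fun j =>
      neg_mul_le_apply_mul (hy1 j) (hyu j).le (by norm_num)
        fun t => ⟨mul_self_nonneg (x t), hx2 t⟩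
    have h1 : u i (y i * (x * x)) + 4 * η ≤ η + N * (4 * η) := by
      calc u i (y i * (x * x)) + 4 * η
          ≤ ∑ j ∈ Finset.range N, (u j (y j * (x * x)) + 4 * η) :=
            Finset.single_le_sum (f := fun j => u j (y j * (x * x)) + 4 * η)
              (fun j _ => by linarith [hpos j]) (Finset.mem_range.2 hi)
        _ ≤ η + N * (4 * η) := by
            rw [Finset.sum_add_distrib]
            simp only [Finset.sum_const, Finset.card_range, nsmul_eq_mul]
            linarith
    have h2 : -(4 * η) ≤ u i (y i * (x * x - (τ ^ 2) • ind A)) := by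
      refine neg_mul_le_apply_mul (hy1 i) (hyu i).le (by norm_num) fun t => ?_
      have hxt := hx2 t
      simp only [lp.coeFn_sub, lp.coeFn_smul, Pi.sub_apply, Pi.smul_apply, smul_eq_mul,
        ind_apply]
      split_ifs with ht
      · have ht' : τ < |x t| := ht
        have : τ ^ 2 ≤ (x * x) t := by
          rw [mul_apply, ← abs_mul_abs_self]
          nlinarith
        constructor <;> nlinarith
      · have : 0 ≤ (x * x) t := mul_self_nonneg (x t)
        constructor <;> linarith
    have h3 := variation_sub_le_apply_mul_ind (hy1 i) (hyu i).le A
    rw [mul_sub, map_sub, mul_smul_comm, map_smul, smul_eq_mul] at h2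
    have h4 : τ ^ 2 * (variation (u i) A - η) ≤ (4 * N + 5) * η := by
      have := mul_le_mul_of_nonneg_left h3 (sq_nonneg τ)
      linarith
    have h5 : variation (u i) A ≤ η * K := by
      rw [mul_comm, ← le_div_iff₀ (by positivity)] at h4
      rw [hK, mul_add, mul_one, mul_div_assoc', mul_comm η]
      linarith
    exact h5.trans_lt hηK
  have h1 : u k x = u k (ind A * x) + u k (ind Aᶜ * (ind Aᶜ * x)) := by
    rw [ind_mul_ind_mul, ← map_add, ← ind_union_mul disjoint_compl_right,
      Set.union_compl_self, ind_univ_mul]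
  have h2 : ‖ind Aᶜ * x‖ ≤ τ := by
    refine norm_le hτ0.le fun t => ?_
    rw [ind_mul_apply]
    split_ifs with ht
    · exact not_lt.1 ht
    · simpa using hτ0.le
  have h3 := abs_apply_ind_mul_le (u k) A x
  have h4 := abs_apply_ind_mul_le (u k) Aᶜ (ind Aᶜ * x)
  have h5 : variation (u k) Aᶜ ≤ M := ((isPosCharge_variation _).mono (Set.subset_univ _)).trans
    ((variation_univ _).trans_le (hM k))
  have h6 : variation (u k) A * ‖x‖ ≤ ε / 4 * 2 :=
    mul_le_mul (hN A hVA k).le hx (norm_nonneg _) (by positivity)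
  have h7 : variation (u k) Aᶜ * ‖ind Aᶜ * x‖ ≤ M * τ :=
    mul_le_mul h5 h2 (norm_nonneg _) hM0
  have h8 : M * τ ≤ ε / 2 := by
    rw [hτ, mul_div_assoc', div_le_div_iff₀ (by positivity) (by positivity)]
    nlinarith
  rw [h1]
  refine (abs_add_le _ _).trans ?_
  linarith

/-- **Grothendieck's theorem**: weak*-null sequences in the dual of `ℓ_∞` are weakly null. -/
theorem weakStarNullIsWeaklyNull : WeakStarNullIsWeaklyNull (LInfty ι) := by
  intro u hu F
  wlog hF : ‖F‖ ≤ 1 generalizing F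
  · obtain ⟨c, hc, hFc⟩ := F.bound
    have hc' : ‖c⁻¹ • F‖ ≤ 1 := ContinuousLinearMap.opNorm_le_bound _ zero_le_one fun φ => by
      rw [smul_apply, norm_smul, norm_inv, Real.norm_of_nonneg hc.le, one_mul,
        inv_mul_le_iff₀ hc]
      exact hFc φ
    simpa [hc.ne'] using (this (c⁻¹ • F) hc').const_mul c
  obtain ⟨M, hM⟩ := banach_steinhaus (g := u) fun x => by
    obtain ⟨C, hC⟩ := (hu x).norm.bddAbove_range
    exact ⟨C, fun n => hC ⟨n, rfl⟩⟩
  refine Metric.tendsto_atTop.2 fun ε hε => ?_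
  obtain ⟨L, η, hη, hL⟩ := exists_forall_apply_mul_self_le hM (uniformlyExhaustive_variation hM hu)
    (show 0 < ε / 4 by positivity)
  -- `S k` consists of the points of the ball that approximate `F` on the first `k` functionals.
  -- Almost minimizers of `L (x * x)` on these convex sets are close to each other, by the
  -- parallelogram law.
  set S : ℕ → Set (LInfty ι) := fun k => {x | ‖x‖ ≤ 1 ∧ ∀ i < k, |u i x - F (u i)| ≤ ε / 4}
  have hSne : ∀ k, ∃ x, x ∈ S k := fun k => by
    obtain ⟨x, hx, hxi⟩ := exists_norm_le_one_forall_abs_sub_le (fun i : Fin k => u i) hF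
      (show 0 < ε / 4 by positivity)
    exact ⟨x, hx, fun i hi => hxi ⟨i, hi⟩⟩
  have hSanti : ∀ {k l x}, k ≤ l → x ∈ S l → x ∈ S k := fun hkl hx =>
    ⟨hx.1, fun i hi => hx.2 i (hi.trans_le hkl)⟩
  have hLabs : ∀ x : LInfty ι, ‖x‖ ≤ 1 → |L (x * x)| ≤ ‖L‖ := fun x hx => by
    have h1 : ‖x * x‖ ≤ 1 := (norm_mul_le x x).trans (by nlinarith [norm_nonneg x])
    exact (L.le_opNorm _).trans (by nlinarith [norm_nonneg L])
  set R : Set ℝ := {r | ∃ k, ∀ x ∈ S k, r ≤ L (x * x)}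
  have hRne : R.Nonempty := ⟨-‖L‖, 0, fun x hx => neg_le_of_abs_le (hLabs x hx.1)⟩
  have hRbdd : BddAbove R := ⟨‖L‖, fun r ⟨k, hr⟩ => by
    obtain ⟨x, hx⟩ := hSne k
    exact (hr x hx).trans ((le_abs_self _).trans (hLabs x hx.1))⟩
  obtain ⟨r, ⟨K, hK⟩, hr⟩ := exists_lt_of_lt_csSup hRne
    (sub_lt_self (sSup R) (show 0 < η / 8 by positivity))
  have hmin : ∀ k, ∃ x ∈ S k, L (x * x) < sSup R + η / 8 := fun k => by
    by_contra! h
    linarith [le_csSup hRbdd ⟨k, h⟩]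
  have hclose : ∀ x ∈ S K, ∀ y ∈ S K, L (x * x) < sSup R + η / 8 → L (y * y) < sSup R + η / 8 →
      ∀ k, |u k (x - y)| ≤ ε / 4 := by
    intro x hx y hy hLx hLy
    refine hL _ ((norm_sub_le _ _).trans (by linarith [hx.1, hy.1])) ?_
    have hmid : (1 / 2 : ℝ) • (x + y) ∈ S K := by
      refine ⟨?_, fun i hi => ?_⟩
      · rw [norm_smul, Real.norm_of_nonneg (by norm_num)]
        linarith [norm_add_le x y, hx.1, hy.1]
      · have h1 := abs_le.1 (hx.2 i hi)
        have h2 := abs_le.1 (hy.2 i hi)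
        rw [map_smul, map_add, smul_eq_mul, abs_le]
        constructor <;> linarith
    have h1 := hK _ hmid
    rw [smul_mul_smul_comm, map_smul, smul_eq_mul] at h1
    have h2 : L ((x - y) * (x - y)) + L ((x + y) * (x + y)) =
        2 * L (x * x) + 2 * L (y * y) := by
      rw [← map_add, show (x - y) * (x - y) + (x + y) * (x + y) =
        x * x + x * x + (y * y + y * y) by
          simp only [sub_mul, mul_sub, add_mul, mul_add]; abel]
      simp only [map_add]
      ring
    linarith
  obtain ⟨x, hx, hLx⟩ := hmin K
  obtain ⟨n, hn⟩ := Metric.tendsto_atTop.1 (hu x) (ε / 4) (by positivity)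
  refine ⟨n, fun k hk => ?_⟩
  obtain ⟨y, hy, hLy⟩ := hmin (max K (k + 1))
  have h1 := hn k hk
  have h2 := abs_le.1 (hclose y (hSanti (le_max_left _ _) hy) x hx hLy hLx k)
  have h3 := abs_le.1 (hy.2 k (lt_max_of_lt_right k.lt_succ_self))
  rw [dist_zero_right, Real.norm_eq_abs, abs_lt] at h1 ⊢
  rw [map_sub] at h2
  constructor <;> linarith

end LInfty

/-! ### The quantities `δ_w` and `δ_{w*}` -/

theorem oscAtTop_le {a : ℕ → ℝ} {r : ℝ} (h : ∀ᶠ k in atTop, |a k| ≤ r) :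
    oscAtTop a ≤ ENNReal.ofReal (2 * r) := by
  obtain ⟨n, hn⟩ := eventually_atTop.1 h
  refine (iInf_le _ n).trans (iSup₂_le fun k hk => iSup₂_le fun l hl => ?_)
  exact ENNReal.ofReal_le_ofReal ((abs_sub _ _).trans (by linarith [hn k hk, hn l hl]))

theorem le_oscAtTop {a : ℕ → ℝ} {r : ℝ} (h : ∀ n, ∃ k ≥ n, ∃ l ≥ n, r ≤ |a k - a l|) :
    ENNReal.ofReal r ≤ oscAtTop a := by
  refine le_iInf fun n => ?_
  obtain ⟨k, hk, l, hl, hr⟩ := h n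
  refine (ENNReal.ofReal_le_ofReal hr).trans ?_
  refine le_iSup₂_of_le k hk ?_
  exact le_iSup₂_of_le (f := fun l _ => ENNReal.ofReal |a k - a l|) l hl le_rfl

section Quant

variable {X Y : Type*} [NormedAddCommGroup X] [NormedSpace ℝ X] [NormedAddCommGroup Y]
  [NormedSpace ℝ Y]

theorem IsQuantGrothendieck.mono {c d : ℝ} (hcd : c ≤ d) (h : IsQuantGrothendieck c X) :
    IsQuantGrothendieck d X := fun u hu =>
  (h u hu).trans (mul_le_mul_left (ENNReal.ofReal_le_ofReal hcd) _)

/-- The `c`-Grothendieck property passes to `1`-complemented subspaces. -/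
theorem IsQuantGrothendieck.of_leftInverse {c : ℝ} {P : Y →L[ℝ] X} {J : X →L[ℝ] Y}
    (hP : ∀ y, ‖P y‖ ≤ ‖y‖) (hJ : ∀ x, ‖J x‖ ≤ ‖x‖) (hPJ : ∀ x, P (J x) = x)
    (h : IsQuantGrothendieck c Y) : IsQuantGrothendieck c X := by
  intro u hu
  obtain ⟨C, hC⟩ := hu.exists_norm_le
  have hP1 : ‖P‖ ≤ 1 := P.opNorm_le_bound zero_le_one fun y => by simpa using hP y
  have hJ1 : ‖J‖ ≤ 1 := J.opNorm_le_bound zero_le_one fun x => by simpa using hJ x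
  have hv : Bornology.IsBounded (Set.range fun k => (u k).comp P) := by
    refine isBounded_iff_forall_norm_le.2 ⟨C, ?_⟩
    rintro _ ⟨k, rfl⟩
    calc ‖(u k).comp P‖ ≤ ‖u k‖ * ‖P‖ := ContinuousLinearMap.opNorm_comp_le _ _
      _ ≤ ‖u k‖ * 1 := by gcongr
      _ ≤ C := by simpa using hC _ ⟨k, rfl⟩
  have h1 : deltaWeak u ≤ deltaWeak fun k => (u k).comp P := by
    refine iSup₂_le fun F hF => ?_
    have hG : ‖F.comp (ContinuousLinearMap.precomp ℝ J)‖ ≤ 1 := by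
      refine ContinuousLinearMap.opNorm_le_bound _ zero_le_one fun φ => ?_
      have h2 : ‖φ.comp J‖ ≤ ‖φ‖ := (ContinuousLinearMap.opNorm_comp_le _ _).trans
        (mul_le_of_le_one_right (norm_nonneg _) hJ1)
      calc ‖F (φ.comp J)‖ ≤ 1 * ‖φ.comp J‖ := F.le_of_opNorm_le hF _
        _ ≤ 1 * ‖φ‖ := by gcongr
    refine le_iSup₂_of_le (F.comp (ContinuousLinearMap.precomp ℝ J)) hG (le_of_eq ?_)
    congr 1
    funext k
    simp only [ContinuousLinearMap.comp_apply, ContinuousLinearMap.precomp_apply]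
    congr 1
    ext x
    simp [hPJ]
  have h2 : (deltaWeakStar fun k => (u k).comp P) ≤ deltaWeakStar u :=
    iSup₂_le fun y hy => le_iSup₂_of_le (f := fun (x : X) (_ : ‖x‖ ≤ 1) => oscAtTop fun k => u k x)
      (P y) ((hP y).trans hy) le_rfl
  exact h1.trans ((h _ hv).trans (mul_le_mul_right h2 _))

end Quant

/-! ### The renormings of `ℓ_∞` -/

namespace LInfty

/-- The subspace `c_0` of `ℓ_∞`. -/
def czero : Submodule ℝ (LInfty ℕ) where
  carrier := {x | Tendsto (fun k => x k) atTop (𝓝 0)}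
  add_mem' hx hy := by simpa using Tendsto.add hx hy
  zero_mem' := tendsto_const_nhds
  smul_mem' c x hx := by simpa using Tendsto.const_mul c hx

theorem mem_czero {x : LInfty ℕ} : x ∈ czero ↔ Tendsto (fun k => x k) atTop (𝓝 0) := Iff.rfl

instance isClosed_czero : IsClosed (czero : Set (LInfty ℕ)) := by
  refine isClosed_of_closure_subset fun x hx => Metric.tendsto_atTop.2 fun ε hε => ?_
  obtain ⟨y, hy, hxy⟩ := Metric.mem_closure_iff.1 hx (ε / 2) (by positivity)
  obtain ⟨n, hn⟩ := Metric.tendsto_atTop.1 hy (ε / 2) (by positivity)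
  refine ⟨n, fun k hk => ?_⟩
  have h1 := hn k hk
  have h2 : |(x - y) k| ≤ ‖x - y‖ := abs_apply_le _ _
  rw [dist_eq_norm] at hxy
  rw [dist_zero_right, Real.norm_eq_abs] at h1 ⊢
  have h3 : x k = (x - y) k + y k := by simp
  rw [h3]
  exact (abs_add_le _ _).trans_lt (by linarith)

/-- The embedding `x ↦ (x, (n + 1) [x])` of `ℓ_∞` into `ℓ_∞ × ℓ_∞ / c_0`. -/
def graphMap (n : ℕ) : LInfty ℕ →ₗ[ℝ] LInfty ℕ × (LInfty ℕ ⧸ czero) :=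
  LinearMap.prod LinearMap.id (((n : ℝ) + 1) • czero.mkQ)

theorem graphMap_injective (n : ℕ) : Function.Injective (graphMap n) := fun _ _ h =>
  congrArg Prod.fst h

/-- The space `ℓ_∞` with the equivalent norm `max ‖x‖_∞ ((n + 1) dist(x, c_0))`, that is, the norm
induced by `LInfty.graphMap n`. -/
def Renormed (_n : ℕ) : Type := LInfty ℕ

namespace Renormed

variable (n : ℕ)

instance : AddCommGroup (Renormed n) := inferInstanceAs (AddCommGroup (LInfty ℕ))

instance : Module ℝ (Renormed n) := inferInstanceAs (Module ℝ (LInfty ℕ))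

/-- The identity map onto `ℓ_∞` with its usual norm. -/
def toLInfty : Renormed n ≃ₗ[ℝ] LInfty ℕ := LinearEquiv.refl ℝ (LInfty ℕ)

instance : NormedAddCommGroup (Renormed n) :=
  NormedAddCommGroup.induced (Renormed n) _ (graphMap n ∘ₗ (toLInfty n).toLinearMap)
    (graphMap_injective n)

instance : NormedSpace ℝ (Renormed n) :=
  NormedSpace.induced ℝ (Renormed n) _ (graphMap n ∘ₗ (toLInfty n).toLinearMap)

variable {n}

theorem norm_eq (x : Renormed n) :
    ‖x‖ = max ‖toLInfty n x‖ (((n : ℝ) + 1) * ‖czero.mkQ (toLInfty n x)‖) := by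
  have h : ‖x‖ = max ‖toLInfty n x‖ ‖((n : ℝ) + 1) • czero.mkQ (toLInfty n x)‖ := rfl
  rw [h, norm_smul, Real.norm_of_nonneg (by positivity)]

theorem norm_toLInfty_le (x : Renormed n) : ‖toLInfty n x‖ ≤ ‖x‖ :=
  (le_max_left _ _).trans (norm_eq x).ge

variable (n) in
/-- The new norm is equivalent to the usual norm of `ℓ_∞`. -/
def equivLInfty : Renormed n ≃L[ℝ] LInfty ℕ :=
  (toLInfty n).toContinuousLinearEquivOfBounds 1 (n + 1)
    (fun x => by simpa using norm_toLInfty_le x)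
    fun x => by
      rw [norm_eq, LinearEquiv.apply_symm_apply]
      refine max_le ?_ ?_
      · exact le_mul_of_one_le_left (norm_nonneg x) (by linarith [n.cast_nonneg (α := ℝ)])
      · gcongr
        exact Submodule.Quotient.norm_mk_le _ x

instance : CompleteSpace (Renormed n) :=
  (completeSpace_congr (e := (equivLInfty n).toEquiv) (equivLInfty n).isUniformEmbedding).2
    inferInstance

variable (n) in
/-- The coordinate functionals. -/
def coord (k : ℕ) : StrongDual ℝ (Renormed n) :=
  (lp.evalCLM ℝ (fun _ : ℕ => ℝ) ∞ k).comp (equivLInfty n : Renormed n →L[ℝ] LInfty ℕ)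

theorem coord_apply (k : ℕ) (x : Renormed n) : coord n k x = toLInfty n x k := rfl

theorem isBounded_range_coord : Bornology.IsBounded (Set.range (coord n)) := by
  refine isBounded_iff_forall_norm_le.2 ⟨1, ?_⟩
  rintro _ ⟨k, rfl⟩
  refine ContinuousLinearMap.opNorm_le_bound _ zero_le_one fun x => ?_
  rw [one_mul]
  exact (abs_apply_le _ _).trans (norm_toLInfty_le x)

/-- The unit ball of the new norm lies within `1 / (n + 1)` of `c_0`. -/
theorem deltaWeakStar_coord_le :
    deltaWeakStar (coord n) ≤ ENNReal.ofReal (2 / ((n : ℝ) + 1)) := by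
  refine iSup₂_le fun x hx => ENNReal.le_of_forall_pos_le_add fun ε hε _ => ?_
  have hε' : (0 : ℝ) < ε := hε
  have hn : (0 : ℝ) < n + 1 := by positivity
  have hq : ‖czero.mkQ (toLInfty n x)‖ ≤ 1 / ((n : ℝ) + 1) := by
    rw [le_div_iff₀ hn, mul_comm]
    exact (le_max_right _ _).trans ((norm_eq x).ge.trans hx)
  obtain ⟨y, hy, hyn⟩ := Submodule.Quotient.norm_mk_lt (czero.mkQ (toLInfty n x))
    (show (0 : ℝ) < ε / 4 by positivity)
  have hxy : Tendsto (fun k => (toLInfty n x - y) k) atTop (𝓝 0) :=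
    mem_czero.1 ((Submodule.Quotient.eq czero).1 hy.symm)
  have hev : ∀ᶠ k in atTop, |coord n k x| ≤ 1 / ((n : ℝ) + 1) + ε / 2 := by
    filter_upwards [Metric.tendsto_nhds.1 hxy (ε / 4) (by positivity)] with k hk
    rw [dist_zero_right, Real.norm_eq_abs] at hk
    have h1 := (abs_apply_le y k).trans hyn.le
    have h2 : coord n k x = (toLInfty n x - y) k + y k := by simp [coord_apply]
    rw [h2]
    exact (abs_add_le _ _).trans (by linarith)
  refine (oscAtTop_le hev).trans (le_of_eq ?_)
  rw [← ENNReal.ofReal_coe_nnreal, ← ENNReal.ofReal_add (by positivity) hε'.le]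
  congr 1
  ring

/-- The signs `(-1) ^ k`, `k < m`, followed by zeros. -/
def signs (m : ℕ) : LInfty ℕ :=
  ofBounded (fun k => if k < m then (-1) ^ k else 0) 1 fun k => by split_ifs <;> simp

theorem norm_symm_signs_le (m : ℕ) : ‖(toLInfty n).symm (signs m)‖ ≤ 1 := by
  have h0 : signs m ∈ czero := by
    refine mem_czero.2 (tendsto_const_nhds.congr' ?_)
    filter_upwards [eventually_ge_atTop m] with k hk
    simp [signs, not_lt.2 hk]
  have h1 : czero.mkQ (signs m) = 0 := (Submodule.Quotient.mk_eq_zero czero).2 h0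
  rw [norm_eq, LinearEquiv.apply_symm_apply, h1]
  refine max_le (norm_le zero_le_one fun k => ?_) (by simp)
  simp only [signs, ofBounded_apply]
  split_ifs <;> simp

/-- The unit ball of the bidual contains the weak* limit points of the unit vectors `signs m`
of `c_0`, on which the coordinates alternate between `1` and `-1`. -/
theorem le_deltaWeak_coord : ENNReal.ofReal 2 ≤ deltaWeak (coord n) := by
  set J : ℕ → WeakDual ℝ (StrongDual ℝ (Renormed n)) := fun m =>
    StrongDual.toWeakDual (NormedSpace.inclusionInDoubleDual ℝ _ ((toLInfty n).symm (signs m)))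
  have hJ : ∀ m, J m ∈ WeakDual.toStrongDual ⁻¹'
      Metric.closedBall (0 : StrongDual ℝ (StrongDual ℝ (Renormed n))) 1 := fun m => by
    refine (mem_closedBall_zero_iff (E := StrongDual ℝ (StrongDual ℝ (Renormed n)))).2 ?_
    exact (NormedSpace.double_dual_bound ℝ _ _).trans (norm_symm_signs_le m)
  obtain ⟨F, hF, hlim⟩ := (WeakDual.isCompact_closedBall
    (0 : StrongDual ℝ (StrongDual ℝ (Renormed n))) 1).ultrafilter_le_nhds'
      ((hyperfilter ℕ).map J) (Filter.mem_map.2 (Filter.Eventually.of_forall hJ))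
  have hFc : ∀ k, WeakDual.toStrongDual F (coord n k) = (-1) ^ k := by
    intro k
    have h1 : Tendsto (fun m => J m (coord n k)) (hyperfilter ℕ : Filter ℕ)
        (𝓝 (F (coord n k))) :=
      ((WeakDual.eval_continuous (coord n k)).tendsto F).comp hlim
    refine tendsto_nhds_unique h1 (tendsto_const_nhds.congr' ?_)
    filter_upwards [Nat.hyperfilter_le_atTop (eventually_gt_atTop k)] with m hm
    have : J m (coord n k) = signs m k := rfl
    rw [this]
    simp only [signs, ofBounded_apply, if_pos hm]
  refine le_iSup₂_of_le (WeakDual.toStrongDual F) (by simpa using hF) (le_oscAtTop fun m => ?_)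
  refine ⟨2 * m, by omega, 2 * m + 1, by omega, ?_⟩
  rw [hFc, hFc, pow_succ, pow_mul]
  norm_num

theorem not_isQuantGrothendieck : ¬ IsQuantGrothendieck (n : ℝ) (Renormed n) := by
  intro h
  have h1 := le_deltaWeak_coord.trans ((h _ isBounded_range_coord).trans
    (mul_le_mul_right deltaWeakStar_coord_le _))
  rw [← ENNReal.ofReal_mul (by positivity), ENNReal.ofReal_le_ofReal_iff (by positivity),
    mul_div_assoc', le_div_iff₀ (by positivity)] at h1
  linarith

end Renormed

end LInfty

end

/-! ### Conclusion -/

/-- There are Banach spaces `E n`, `n = 1, 2, …`, each of them `ℓ_∞` with an equivalent norm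
(that is, linearly homeomorphic to `ℓ_∞`) and not `n`-Grothendieck, whose `ℓ_2`-sum is a
Grothendieck Banach space that is not `c`-Grothendieck for any `c ≥ 1`. -/
theorem theorem1p3 :
    ∃ (E : ℕ+ → Type) (_ : ∀ n, NormedAddCommGroup (E n)) (_ : ∀ n, NormedSpace ℝ (E n)),
      (∀ n, Nonempty (E n ≃L[ℝ] lp (fun _ : ℕ => ℝ) ∞) ∧
        ¬ IsQuantGrothendieck ((n : ℕ) : ℝ) (E n)) ∧
      CompleteSpace (lp E 2) ∧
      IsGrothendieck (lp E 2) ∧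
      ∀ c : ℝ, 1 ≤ c → ¬ IsQuantGrothendieck c (lp E 2) := by
  refine ⟨fun n => LInfty.Renormed n, fun n => inferInstance, fun n => inferInstance,
    fun n => ⟨⟨LInfty.Renormed.equivLInfty n⟩, LInfty.Renormed.not_isQuantGrothendieck⟩,
    inferInstance, ?_, fun c _ h => ?_⟩
  · exact isGrothendieck_of_weakStarNullIsWeaklyNull (WeakStarNullIsWeaklyNull.lp_two fun n =>
      LInfty.weakStarNullIsWeaklyNull.of_equiv (LInfty.Renormed.equivLInfty n))
  · obtain ⟨m, hm⟩ := exists_nat_ge c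
    let n : ℕ+ := m.succPNat
    have hn : c ≤ ((n : ℕ) : ℝ) := hm.trans (by simp [n])
    refine LInfty.Renormed.not_isQuantGrothendieck (n := n) ((h.mono hn).of_leftInverse
      (P := lp.evalCLM ℝ (fun n : ℕ+ => LInfty.Renormed n) 2 n)
      (J := lp.singleContinuousLinearMap ℝ (fun n : ℕ+ => LInfty.Renormed n) 2 n)
      (fun y => ?_) (fun x => ?_) fun x => ?_)
    · exact lp.norm_apply_le_norm two_ne_zero y n
    · exact (lp.norm_single (E := fun n : ℕ+ => LInfty.Renormed n) two_pos n x).le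
    · exact lp.single_apply_self (E := fun n : ℕ+ => LInfty.Renormed n) 2 n x
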